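/- Let $\Theta$ and $\mathbb Y$ be Polish metric spaces with their Borel $\sigma$-algebras; call a measure locally finite if it is finite on sets of bounded diameter. Let $\mathrm{BM}_+(\Theta)$ be the set of measurable, nonnegative, bounded functions with bounded support. A random locally finite measure $W$ on $\Theta$ is a gamma random measure, $W\sim\mathrm{GaP}(H,b)$ with $b>0$, if $E(e^{-\int f\,dW})=\exp(-\int\log(1+f/b)\,dH)$ for all $f\in \mathrm{BM}_+(\Theta)$; it is a noncentral gamma random measure, $W\sim\mathrm{NcGaP}(H,M,c^{-1})$ with $c>0$, if $E(e^{-\int f\,dW})=\exp\big(-\int\log(1+cf)\,dH-\int\frac{cf}{1+cf}\,dM\big)$ for all such $f$. Let $H$ be a locally finite measure on $\Theta$, $\beta_t,c_t>0$ for $t\ge 2$, and let $(W_t)_{t\ge1}$ be an M-ARG(1) process, i.e. a Markov process of random locally finite measures on $\Theta$ with $W_{t+1}\mid W_t\sim \mathrm{NcGaP}(H,\beta_{t+1}W_t,c_{t+1}^{-1})$. Let $\ell$ be a $\sigma$-finite measure on $\mathbb Y$, $K_\phi:\mathbb Y\times\Theta\to[0,\infty)$ measurable, $(\kappa_t)_{t\ge1}$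 nonnegative constants. Let $(N_t)_{t\ge1}$ be the SN-M-ARG(1) process driven by $(W_t)_{t\ge 1}$: conditionally on $(W_t)_{t\ge1}$ the $N_t$ are independent Poisson random measures on $\mathbb Y$ with mean measures $\Lambda_t(dy)=\kappa_t\int_\Theta K_\phi(y,\theta)W_t(d\theta)\,\ell(dy)$. Write $\bar W_1(\cdot)=E(W_1(\cdot))$ and $K_\phi(B,\theta)=\int_B K_\phi(y,\theta)\,\ell(dy)$. Assume, for all bounded measurable $B,B_1,B_2\subset\mathbb Y$: - $(H_1)$ $K_\phi(B,\theta)<\infty$ for all $\theta$, and $\int_B\int_\Theta K_\phi(y,\theta)\,[H+\bar W_1](d\theta)\,\ell(dy)<\infty$; - $(H_2)$ $\int_{B_1\times B_2}\int_\Theta K_\phi(y_1,\theta)K_\phi(y_2,\theta)\,[H+\bar W_1](d\theta)\,\ell(dy_1)\ell(dy_2)<\infty$; - $(H_3)$ $E\big(\int_{B_1\times B_2}\int_\Theta K_\phi(y_1,\theta_1)W_1(d\theta_1)\int_\Theta K_\phi(y_2,\theta_2)W_1(d\theta_2)\,\ell(dy_1)\ell(dy_2)\big)<\infty$; - $(H_4)$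 $c_t=c$ and $\beta_t=\beta$ for all $t\ge 2$, $\rho=\beta c<1$, and $W_1\sim \mathrm{GaP}(H,(1-\rho)/c)$. Then, for all integers $t\ge1$, $h\ge0$: 1. for every measurable $B_1\subset\mathbb Y$, as an identity in $[0,\infty]$, $$E(N_t(B_1))=\frac{c\,\kappa_t}{1-\rho}\int_\Theta K_\phi(B_1,\theta)\,H(d\theta);$$ 2. for all measurable $B_1,B_2\subset\mathbb Y$ such that $\int K_\phi(B_1,\theta)H(d\theta)$, $\int K_\phi(B_2,\theta)H(d\theta)$ and $\int K_\phi(B_1,\theta)K_\phi(B_2,\theta)H(d\theta)$ are finite (which holds for all bounded measurable $B_1,B_2$), the variables $N_t(B_1)$, $N_{t+h}(B_2)$ and their product are integrable and $$\mathrm{cov}(N_t(B_1),N_{t+h}(B_2))=\mathbf 1\{h=0\}\frac{c\,\kappa_t}{1-\rho}\int_\Theta K_\phi(B_1\cap B_2,\theta)\,H(d\theta)+\frac{\rho^h c^2\kappa_t\kappa_{t+h}}{(1-\rho)^2}\int_\Theta K_\phi(B_1,\theta)K_\phi(B_2,\theta)\,H(d\theta).$$ -/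

import Mathlib

open MeasureTheory ProbabilityTheory
open scoped ENNReal NNReal

noncomputable section

/-- A locally finite measure: every set of bounded diameter has finite mass. -/
def IsBoundedlyFinite {E : Type*} [MetricSpace E] [MeasurableSpace E] (μ : Measure E) : Prop :=
  ∀ s : Set E, Bornology.IsBounded s → μ s < ∞

/-- The class `BM₊(E)` of measurable, nonnegative, bounded functions with bounded support. -/
structure IsBMPlus {E : Type*} [MetricSpace E] [MeasurableSpace E] (f : E → ℝ) : Prop where
  measurable : Measurable f
  nonneg : ∀ x, 0 ≤ f x
  bounded : ∃ C : ℝ, ∀ x, f x ≤ C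
  support_bounded : Bornology.IsBounded (Function.support f)

/-- The Laplace functional `f ↦ E (exp (- ∫ f dW))` of a random measure `W` with law `Q`. -/
def laplaceFunctional {E : Type*} [MeasurableSpace E] (Q : Measure (Measure E)) (f : E → ℝ) : ℝ :=
  ∫ μ, Real.exp (-∫ x, f x ∂μ) ∂Q

/-- `Q` is the law of a gamma random measure `GaP(H, b)` with base measure `H` and rate
(inverse scale) `b`. -/
structure IsGammaLaw {E : Type*} [MetricSpace E] [MeasurableSpace E]
    (H : Measure E) (b : ℝ) (Q : Measure (Measure E)) : Prop where
  isProbabilityMeasure : IsProbabilityMeasure Q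
  boundedlyFinite : ∀ᵐ μ ∂Q, IsBoundedlyFinite μ
  laplace : ∀ f : E → ℝ, IsBMPlus f →
    laplaceFunctional Q f = Real.exp (-∫ x, Real.log (1 + f x / b) ∂H)

/-- `Q` is the law of a noncentral gamma random measure `NcGaP(H, M, c⁻¹)`. -/
structure IsNoncentralGammaLaw {E : Type*} [MetricSpace E] [MeasurableSpace E]
    (H M : Measure E) (c : ℝ) (Q : Measure (Measure E)) : Prop where
  isProbabilityMeasure : IsProbabilityMeasure Q
  boundedlyFinite : ∀ᵐ μ ∂Q, IsBoundedlyFinite μ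
  laplace : ∀ f : E → ℝ, IsBMPlus f →
    laplaceFunctional Q f =
      Real.exp (-(∫ x, Real.log (1 + c * f x) ∂H) - ∫ x, c * f x / (1 + c * f x) ∂M)

/-- The Poisson distribution on `ℕ ∪ {∞}` with mean `a ∈ [0, ∞]` (a unit mass at `∞` if
`a = ∞`), as a measure on `[0, ∞]`. -/
def extendedPoisson (a : ℝ≥0∞) : Measure ℝ≥0∞ :=
  if a = ∞ then Measure.dirac ∞
  else (poissonMeasure a.toNNReal).map (fun n : ℕ => (n : ℝ≥0∞))

/-- `Q` is the law of a Poisson random measure with mean measure `L`: the mass of every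
measurable set `B` is Poisson with mean `L B`, and the masses of pairwise disjoint measurable sets
are independent. -/
structure IsPoissonLaw {E : Type*} [MeasurableSpace E]
    (L : Measure E) (Q : Measure (Measure E)) : Prop where
  isProbabilityMeasure : IsProbabilityMeasure Q
  count : ∀ B : Set E, MeasurableSet B → Q.map (fun μ => μ B) = extendedPoisson (L B)
  indep : ∀ (n : ℕ) (B : Fin n → Set E), (∀ i, MeasurableSet (B i)) →
    Pairwise (fun i j => Disjoint (B i) (B j)) →
    iIndepFun (fun (i : Fin n) (μ : Measure E) => μ (B i)) Q

/-- `(W t)_{t ≥ 1}` is an M-ARG(1) process: a Markov process of random locally finite measures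
such that the conditional law of `W (t+1)` given `W t` is `NcGaP(H, β (t+1) • W t, c (t+1)⁻¹)`.
The parameters `β t, c t` are used for `t ≥ 2` only, and `W 0` plays no role. -/
structure IsMARG {Θ : Type*} [MetricSpace Θ] [MeasurableSpace Θ]
    {Ω : Type*} [MeasurableSpace Ω] (P : Measure Ω)
    (H : Measure Θ) (β c : ℕ → ℝ) (W : ℕ → Ω → Measure Θ) : Prop where
  base : IsBoundedlyFinite H
  β_pos : ∀ t, 2 ≤ t → 0 < β t
  c_pos : ∀ t, 2 ≤ t → 0 < c t
  measurable : ∀ t, 1 ≤ t → Measurable (W t)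
  boundedlyFinite : ∀ t, 1 ≤ t → ∀ᵐ ω ∂P, IsBoundedlyFinite (W t ω)
  /- The regular conditional law of `W (t+1)` given the past `(W 1, …, W t)` is `κ (W t)`. -/
  transition : ∀ (t : ℕ) (ht : 1 ≤ t), ∃ κ : Kernel (Measure Θ) (Measure Θ), IsMarkovKernel κ ∧
    HasCondDistrib (W (t + 1)) (fun ω (s : Set.Icc 1 t) => W s ω)
      (κ.comap (fun w : Set.Icc 1 t → Measure Θ => w ⟨t, ht, le_rfl⟩) (measurable_pi_apply _)) P ∧
    ∀ᵐ ω ∂P, IsNoncentralGammaLaw H (ENNReal.ofReal (β (t + 1)) • W t ω) (c (t + 1)) (κ (W t ω))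

/-- The intensity measure `Λ(dy) = k λ(y) ℓ(dy)`, where `λ(y) = ∫ K(y, θ) w(dθ)`. -/
def shotNoiseIntensity {Y Θ : Type*} [MeasurableSpace Y] [MeasurableSpace Θ]
    (l : Measure Y) (K : Y → Θ → ℝ≥0) (k : ℝ≥0) (w : Measure Θ) : Measure Y :=
  k • l.withDensity (fun y => ∫⁻ θ, K y θ ∂w)

/-- `(N t)_{t ≥ 1}` is a SN-M-ARG(1) process driven by the M-ARG(1) process `(W t)_{t ≥ 1}`:
conditionally on `(W t)_{t ≥ 1}`, the random measures `N t` are independent, and `N t` is a Poisson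
random measure with mean measure `Λ t`, the shot noise intensity of `W t`. -/
structure IsSNMARG {Θ Y : Type*} [MetricSpace Θ] [MeasurableSpace Θ] [MeasurableSpace Y]
    {Ω : Type*} [MeasurableSpace Ω] (P : Measure Ω)
    (H : Measure Θ) (β c : ℕ → ℝ) (l : Measure Y) (K : Y → Θ → ℝ≥0) (k : ℕ → ℝ≥0)
    (W : ℕ → Ω → Measure Θ) (N : ℕ → Ω → Measure Y) : Prop where
  marg : IsMARG P H β c W
  measurable : ∀ t, 1 ≤ t → Measurable (N t)
  cox : ∃ κ : Kernel (Set.Ici (1 : ℕ) → Measure Θ) (Set.Ici (1 : ℕ) → Measure Y), IsMarkovKernel κ ∧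
    HasCondDistrib (fun ω (t : Set.Ici (1 : ℕ)) => N t ω) (fun ω (t : Set.Ici (1 : ℕ)) => W t ω) κ P ∧
    ∀ᵐ ω ∂P,
      iIndepFun (fun (t : Set.Ici (1 : ℕ)) (n : Set.Ici (1 : ℕ) → Measure Y) => n t)
        (κ (fun t : Set.Ici (1 : ℕ) => W t ω)) ∧
      ∀ t : Set.Ici (1 : ℕ), IsPoissonLaw (shotNoiseIntensity l K (k t) (W t ω))
        ((κ (fun s : Set.Ici (1 : ℕ) => W s ω)).map (fun n => n t))

/-- The mean measure `A ↦ E (W A)` of a random measure `W`. -/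
def meanMeasure {E : Type*} [MeasurableSpace E] {Ω : Type*} [MeasurableSpace Ω]
    (P : Measure Ω) (W : Ω → Measure E) : Measure E :=
  P.bind W

/-- Condition `(H₁)`. -/
def CondH1 {Θ Y : Type*} [MeasurableSpace Θ] [MetricSpace Y] [MeasurableSpace Y]
    {Ω : Type*} [MeasurableSpace Ω] (P : Measure Ω)
    (H : Measure Θ) (l : Measure Y) (K : Y → Θ → ℝ≥0) (W₁ : Ω → Measure Θ) : Prop :=
  ∀ B : Set Y, MeasurableSet B → Bornology.IsBounded B →
    (∀ θ, ∫⁻ y in B, K y θ ∂l < ∞) ∧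
    ∫⁻ y in B, ∫⁻ θ, K y θ ∂(H + meanMeasure P W₁) ∂l < ∞

/-- Condition `(H₂)`. -/
def CondH2 {Θ Y : Type*} [MeasurableSpace Θ] [MetricSpace Y] [MeasurableSpace Y]
    {Ω : Type*} [MeasurableSpace Ω] (P : Measure Ω)
    (H : Measure Θ) (l : Measure Y) (K : Y → Θ → ℝ≥0) (W₁ : Ω → Measure Θ) : Prop :=
  ∀ B₁ B₂ : Set Y, MeasurableSet B₁ → Bornology.IsBounded B₁ →
    MeasurableSet B₂ → Bornology.IsBounded B₂ →
    ∫⁻ p in B₁ ×ˢ B₂, ∫⁻ θ, (K p.1 θ : ℝ≥0∞) * K p.2 θ ∂(H + meanMeasure P W₁) ∂(l.prod l) < ∞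

/-- Condition `(H₃)`. -/
def CondH3 {Θ Y : Type*} [MeasurableSpace Θ] [MetricSpace Y] [MeasurableSpace Y]
    {Ω : Type*} [MeasurableSpace Ω] (P : Measure Ω)
    (l : Measure Y) (K : Y → Θ → ℝ≥0) (W₁ : Ω → Measure Θ) : Prop :=
  ∀ B₁ B₂ : Set Y, MeasurableSet B₁ → Bornology.IsBounded B₁ →
    MeasurableSet B₂ → Bornology.IsBounded B₂ →
    ∫⁻ ω, ∫⁻ p in B₁ ×ˢ B₂,
      (∫⁻ θ, K p.1 θ ∂(W₁ ω)) * (∫⁻ θ, K p.2 θ ∂(W₁ ω)) ∂(l.prod l) ∂P < ∞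

/-- Condition `(H₄)` (time stationarity): the parameters are constant, `ρ = b₀ c₀ < 1`, and
`W₁ ~ GaP(H, (1 - ρ) / c₀)`. -/
structure CondH4 {Θ : Type*} [MetricSpace Θ] [MeasurableSpace Θ]
    {Ω : Type*} [MeasurableSpace Ω] (P : Measure Ω)
    (H : Measure Θ) (β c : ℕ → ℝ) (b₀ c₀ ρ : ℝ) (W₁ : Ω → Measure Θ) : Prop where
  c_const : ∀ t, 2 ≤ t → c t = c₀
  β_const : ∀ t, 2 ≤ t → β t = b₀
  ρ_eq : ρ = b₀ * c₀
  ρ_lt_one : ρ < 1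
  initial : IsGammaLaw H ((1 - ρ) / c₀) (P.map W₁)

/-- `K(B, θ) = ∫_B K(y, θ) ℓ(dy)`. -/
def kernelMass {Y Θ : Type*} [MeasurableSpace Y] (l : Measure Y) (K : Y → Θ → ℝ≥0)
    (B : Set Y) (θ : Θ) : ℝ≥0∞ :=
  ∫⁻ y in B, K y θ ∂l

end

/-! ### Poisson moments, conditioning, and differentiation of Laplace transforms -/

section Preliminaries

open Filter Topology

/-! All moments are computed as identities in `[0, ∞]`, so integrability matters only when
covariances are formed at the very end.

Given the driver, `N t B` is Poisson, with a mean that by Tonelli equals `k t` times the integral of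
`kernelMass l K B` against `W t`. Hence moments of `N` reduce to moments of linear functionals of
`W`, plus one diagonal Poisson term when the two times agree
(`IsPoissonLaw.lintegral_apply_mul_apply`).

Moments of gamma random measures come from differentiating the Laplace functional at 0 along
indicators of bounded sets (`lintegral_mul_ofReal_of_hasDerivWithinAt_laplace`). Equality of
measures then carries them from sets to arbitrary nonnegative functions
(`IsGammaLaw.lintegral_lintegral_mul_lintegral`).

The law `GaP(H, (1 - ρ) / c)` is invariant under the transition, because the two logarithms in the
exponent combine into one (`IsMARG.isGammaLaw_succ`). The conditional mean of `W (t + 1)` given the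
past is `c (H + β W t)`. Put `m = c / (1 - ρ)`, so that `m = c + ρ m`. Induction on the lag then
gives the mixed moment `m² (H(F) H(G) + ρ ^ h H(F G))` (`CondH4.lintegral_mul_lintegral`): the
product term is reproduced at each step, and the correlation term gains a factor `ρ`. Subtracting
the product of the means leaves the stated covariance. -/

lemma lintegral_natCast_mul_poissonMeasure (r : ℝ≥0) (g : ℕ → ℝ≥0∞) :
    ∫⁻ n : ℕ, (n : ℝ≥0∞) * g n ∂(poissonMeasure r) =
      r * ∫⁻ n : ℕ, g (n + 1) ∂(poissonMeasure r) := by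
  simp only [poissonMeasure, lintegral_sum_measure, lintegral_smul_measure, lintegral_dirac,
    smul_eq_mul]
  rw [tsum_eq_zero_add' ENNReal.summable, ← ENNReal.tsum_mul_left]
  simp only [Nat.cast_zero, zero_mul, mul_zero, zero_add]
  refine tsum_congr fun n => ?_
  rw [← mul_assoc, ← mul_assoc]
  congr 1
  rw [show ((n + 1 : ℕ) : ℝ≥0∞) = ENNReal.ofReal (n + 1 : ℝ) by
      rw [← Nat.cast_succ, ENNReal.ofReal_natCast],
    ← ENNReal.ofReal_coe_nnreal, ← ENNReal.ofReal_mul (by positivity),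
    ← ENNReal.ofReal_mul (by positivity)]
  congr 1
  rw [Nat.factorial_succ]
  push_cast
  field_simp
  ring

lemma lintegral_id_extendedPoisson (a : ℝ≥0∞) : ∫⁻ x, x ∂(extendedPoisson a) = a := by
  unfold extendedPoisson
  split_ifs with h
  · rw [lintegral_dirac' _ (by fun_prop), h]
  · rw [lintegral_map (by fun_prop) .of_discrete]
    have := lintegral_natCast_mul_poissonMeasure a.toNNReal 1
    simpa [ENNReal.coe_toNNReal h] using this

/-- The size-biasing identity is applied twice, first with `g n = n` and then with `g = 1`. At `a =
∞` both sides are infinite. -/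
lemma lintegral_sq_extendedPoisson (a : ℝ≥0∞) :
    ∫⁻ x, x * x ∂(extendedPoisson a) = a * a + a := by
  unfold extendedPoisson
  split_ifs with h
  · rw [lintegral_dirac' _ (by fun_prop), h]; simp
  · rw [lintegral_map (by fun_prop) .of_discrete, lintegral_natCast_mul_poissonMeasure]
    have := lintegral_natCast_mul_poissonMeasure a.toNNReal 1
    simp only [Pi.one_apply, mul_one, lintegral_one, measure_univ, ENNReal.coe_toNNReal h] at this
    simp only [Nat.cast_add, Nat.cast_one]
    rw [lintegral_add_right _ measurable_const, this]
    simp [ENNReal.coe_toNNReal h, mul_add]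

lemma lintegral_prod_mk_of_hasCondDistrib {Ω S T : Type*} [MeasurableSpace Ω] [MeasurableSpace S]
    [MeasurableSpace T] {P : Measure Ω} [IsProbabilityMeasure P] {X : Ω → S} {Y : Ω → T}
    {κ : Kernel S T} [IsMarkovKernel κ] (h : HasCondDistrib Y X κ P)
    {F : S → T → ℝ≥0∞} (hF : Measurable (Function.uncurry F)) :
    ∫⁻ ω, F (X ω) (Y ω) ∂P = ∫⁻ ω, ∫⁻ y, F (X ω) y ∂(κ (X ω)) ∂P := by
  have hX := h.aemeasurable_fst
  have h1 := h.lintegral_comp (f := Function.uncurry F) hF.aemeasurable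
  have : IsProbabilityMeasure (P.map X) := Measure.isProbabilityMeasure_map hX
  rw [Measure.lintegral_compProd hF] at h1
  rw [lintegral_map' hF.lintegral_kernel_prod_right'.aemeasurable hX] at h1
  exact h1

/-- Two measures that agree on bounded measurable sets are equal. -/
lemma Measure.ext_of_bounded {E : Type*} [MetricSpace E] [MeasurableSpace E] [BorelSpace E]
    {μ ν : Measure E}
    (h : ∀ A, MeasurableSet A → Bornology.IsBounded A → μ A = ν A) : μ = ν := by
  ext A hA
  rcases isEmpty_or_nonempty E with hE | ⟨⟨x⟩⟩
  · rw [Set.eq_empty_of_isEmpty A]; simp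
  -- Exhaustion by balls uses only continuity from below, so the measures may be infinite on bounded
  -- sets.
  have hU : A = ⋃ n : ℕ, A ∩ Metric.ball x n := by
    rw [← Set.inter_iUnion, Metric.iUnion_ball_nat, Set.inter_univ]
  have hm : Monotone fun n : ℕ => A ∩ Metric.ball x n := fun m n hmn =>
    Set.inter_subset_inter_right _ (Metric.ball_subset_ball (by exact_mod_cast hmn))
  rw [hU, hm.measure_iUnion, hm.measure_iUnion]
  exact iSup_congr fun n => h _ (hA.inter measurableSet_ball)
    (Metric.isBounded_ball.subset Set.inter_subset_right)

/-- The right derivative at `0` of a weighted Laplace transform is minus the weighted mean. -/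
lemma lintegral_mul_ofReal_of_hasDerivWithinAt_laplace {Ω : Type*} [MeasurableSpace Ω]
    {P : Measure Ω} {Z : Ω → ℝ≥0∞} {X : Ω → ℝ} (hZ : Measurable Z) (hZt : ∀ ω, Z ω ≠ ∞) (hX : Measurable X)
    (hX0 : ∀ ω, 0 ≤ X ω) {ψ : ℝ → ℝ} {d : ℝ}
    (hψ : ∀ s, 0 ≤ s → ∫⁻ ω, Z ω * ENNReal.ofReal (Real.exp (-(s * X ω))) ∂P = ENNReal.ofReal (ψ s))
    (hψ0 : ∀ s, 0 ≤ s → 0 ≤ ψ s) (hd : HasDerivWithinAt ψ d (Set.Ioi 0) 0) :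
    ∫⁻ ω, Z ω * ENNReal.ofReal (X ω) ∂P = ENNReal.ofReal (-d) := by
  set s : ℕ → ℝ := fun n => 1 / ((n : ℝ) + 1)
  have hs : ∀ n, 0 < s n := fun n => Nat.one_div_pos_of_nat
  have hs0 : Tendsto s atTop (𝓝[>] 0) :=
    tendsto_nhdsWithin_iff.2 ⟨tendsto_one_div_add_atTop_nhds_zero_nat, .of_forall hs⟩
  -- These difference quotients converge to `X` and stay below it. Their `Z`-weighted integrals are
  -- the negated slopes of `ψ`.
  set q : ℕ → Ω → ℝ := fun n ω => (1 - Real.exp (-(s n * X ω))) / s n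
  have hq_le : ∀ n ω, q n ω ≤ X ω := fun n ω => by
    rw [div_le_iff₀ (hs n)]
    nlinarith [Real.add_one_le_exp (-(s n * X ω))]
  have hq_nonneg : ∀ n ω, 0 ≤ q n ω := fun n ω =>
    div_nonneg (sub_nonneg.2 (Real.exp_le_one_iff.2
      (neg_nonpos.2 (mul_nonneg (hs n).le (hX0 ω))))) (hs n).le
  have hq_lim : ∀ ω, Tendsto (fun n => q n ω) atTop (𝓝 (X ω)) := fun ω => by
    have h1 : HasDerivAt (fun u : ℝ => Real.exp (-(u * X ω))) (-X ω) 0 := by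
      have := (((hasDerivAt_id (0 : ℝ)).mul_const (X ω)).neg).exp
      simpa using this
    have h2 := (hasDerivWithinAt_iff_tendsto_slope' (s := Set.Ioi (0:ℝ)) (by simp)).1
      h1.hasDerivWithinAt
    have h3 := (h2.comp hs0).neg
    simp only [neg_neg] at h3
    refine h3.congr fun n => ?_
    simp only [Function.comp, slope_def_field, q, sub_zero, zero_mul, neg_zero, Real.exp_zero]
    ring
  have hq_int : ∀ n, ∫⁻ ω, Z ω * ENNReal.ofReal (q n ω) ∂P =
      ENNReal.ofReal (-slope ψ 0 (s n)) := fun n => by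
    have hm : Measurable fun ω => Z ω * ENNReal.ofReal (Real.exp (-(s n * X ω))) := by fun_prop
    have h0 := hψ 0 le_rfl
    simp only [zero_mul, neg_zero, Real.exp_zero, ENNReal.ofReal_one, mul_one] at h0
    have h1 : ∀ ω, Z ω * ENNReal.ofReal (q n ω) =
        (Z ω - Z ω * ENNReal.ofReal (Real.exp (-(s n * X ω)))) * ENNReal.ofReal (1 / s n) := by
      intro ω
      rw [show q n ω = (1 - Real.exp (-(s n * X ω))) * (1 / s n) by simp only [q]; ring,
        ENNReal.ofReal_mul' (by have := hs n; positivity), ← mul_assoc,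
        ENNReal.ofReal_sub _ (Real.exp_pos _).le, ENNReal.mul_sub (fun _ _ => hZt ω)]
      simp
    simp_rw [h1]
    rw [lintegral_mul_const _ (by fun_prop), lintegral_sub hm, h0, hψ _ (hs n).le,
      ← ENNReal.ofReal_sub _ (hψ0 _ (hs n).le), ← ENNReal.ofReal_mul' (by have := hs n; positivity)]
    · congr 1
      rw [slope_def_field]
      ring
    · rw [hψ _ (hs n).le]
      exact ENNReal.ofReal_ne_top
    · refine .of_forall fun ω => mul_le_of_le_one_right' (ENNReal.ofReal_le_one.2 ?_)
      exact Real.exp_le_one_iff.2 (neg_nonpos.2 (mul_nonneg (hs n).le (hX0 ω)))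
  have hlim : Tendsto (fun n => ENNReal.ofReal (-slope ψ 0 (s n))) atTop
      (𝓝 (ENNReal.ofReal (-d))) :=
    (ENNReal.continuous_ofReal.tendsto _).comp
      (((hasDerivWithinAt_iff_tendsto_slope' (by simp)).1 hd).comp hs0).neg
  -- Fatou gives `≤` and the bound `q n ≤ X` gives `≥`; integrability of `X` is a consequence, not
  -- an assumption.
  apply le_antisymm
  · calc ∫⁻ ω, Z ω * ENNReal.ofReal (X ω) ∂P
        ≤ ∫⁻ ω, liminf (fun n => Z ω * ENNReal.ofReal (q n ω)) atTop ∂P := by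
          refine lintegral_mono fun ω => ?_
          exact (ENNReal.Tendsto.const_mul ((ENNReal.continuous_ofReal.tendsto _).comp (hq_lim ω))
            (.inr (hZt ω))).liminf_eq.ge
      _ ≤ liminf (fun n => ∫⁻ ω, Z ω * ENNReal.ofReal (q n ω) ∂P) atTop :=
          lintegral_liminf_le fun n => by fun_prop
      _ = _ := by simp_rw [hq_int]; exact hlim.liminf_eq
  · refine le_of_tendsto hlim (.of_forall fun n => ?_)
    rw [← hq_int]
    exact lintegral_mono fun ω => by gcongr; exact hq_le n ω

end Preliminaries

/-! ### First and second moments of gamma and noncentral gamma random measures -/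

section RandomMeasure
variable {E : Type*} [MetricSpace E] [MeasurableSpace E]

lemma IsBMPlus.integrable {f : E → ℝ} (hf : IsBMPlus f) {μ : Measure E}
    (hμ : IsBoundedlyFinite μ) : Integrable f μ := by
  obtain ⟨C, hC⟩ := hf.bounded
  rw [← integrableOn_iff_integrable_of_support_subset subset_rfl]
  exact Measure.integrableOn_of_bounded (hμ _ hf.support_bounded).ne
    hf.measurable.aestronglyMeasurable (M := C)
    (.of_forall fun x => by rw [Real.norm_of_nonneg (hf.nonneg x)]; exact hC x)

/-- The two bounds on `g` force `g 0 = 0`, so the support does not grow. -/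
lemma IsBMPlus.comp {f : E → ℝ} (hf : IsBMPlus f) {g : ℝ → ℝ} (hg : Measurable g) {a : ℝ}
    (hg0 : ∀ x, 0 ≤ x → 0 ≤ g x) (hga : ∀ x, 0 ≤ x → g x ≤ a * x) (ha : 0 ≤ a) :
    IsBMPlus fun x => g (f x) where
  measurable := hg.comp hf.measurable
  nonneg x := hg0 _ (hf.nonneg x)
  bounded := by
    obtain ⟨C, hC⟩ := hf.bounded
    exact ⟨a * C, fun x => (hga _ (hf.nonneg x)).trans (mul_le_mul_of_nonneg_left (hC x) ha)⟩
  support_bounded := hf.support_bounded.subset fun x hx hfx => hx (by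
    have h1 := hg0 0 le_rfl
    have h2 := hga 0 le_rfl
    simp only [hfx]
    linarith)

lemma IsBMPlus.log_one_add_mul {f : E → ℝ} (hf : IsBMPlus f) {c : ℝ} (hc : 0 ≤ c) :
    IsBMPlus fun x => Real.log (1 + c * f x) :=
  hf.comp (g := fun y => Real.log (1 + c * y)) (a := c) (by fun_prop)
    (fun y hy => Real.log_nonneg (by nlinarith [mul_nonneg hc hy]))
    (fun y hy => by
      have := Real.log_le_sub_one_of_pos (x := 1 + c * y) (by nlinarith [mul_nonneg hc hy])
      linarith) hc

lemma IsBMPlus.mul_div_one_add_mul {f : E → ℝ} (hf : IsBMPlus f) {c : ℝ} (hc : 0 ≤ c) :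
    IsBMPlus fun x => c * f x / (1 + c * f x) :=
  hf.comp (g := fun y => c * y / (1 + c * y)) (a := c) (by fun_prop)
    (fun y hy => by positivity)
    (fun y hy => div_le_self (by positivity) (by nlinarith [mul_nonneg hc hy])) hc

lemma IsBMPlus.const_mul {f : E → ℝ} (hf : IsBMPlus f) {c : ℝ} (hc : 0 ≤ c) :
    IsBMPlus fun x => c * f x :=
  hf.comp (g := fun y => c * y) (a := c) (by fun_prop) (fun y hy => by positivity)
    (fun y hy => le_rfl) hc

lemma IsBMPlus.indicator_const {A : Set E} (hA : MeasurableSet A) (hb : Bornology.IsBounded A)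
    {u : ℝ} (hu : 0 ≤ u) : IsBMPlus (A.indicator fun _ => u) where
  measurable := measurable_const.indicator hA
  nonneg := fun x => Set.indicator_nonneg (fun _ _ => hu) x
  bounded := ⟨u, fun x => Set.indicator_le_self' (fun _ _ => hu) x⟩
  support_bounded := hb.subset Set.support_indicator_subset

lemma IsBMPlus.add {f g : E → ℝ} (hf : IsBMPlus f) (hg : IsBMPlus g) :
    IsBMPlus fun x => f x + g x where
  measurable := hf.measurable.add hg.measurable
  nonneg x := add_nonneg (hf.nonneg x) (hg.nonneg x)
  bounded := by
    obtain ⟨C, hC⟩ := hf.bounded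
    obtain ⟨D, hD⟩ := hg.bounded
    exact ⟨C + D, fun x => add_le_add (hC x) (hD x)⟩
  support_bounded := (hf.support_bounded.union hg.support_bounded).subset
    (Function.support_add f g)

lemma IsBMPlus.measurable_integral {f : E → ℝ} (hf : IsBMPlus f) :
    Measurable fun μ : Measure E => ∫ x, f x ∂μ := by
  have : (fun μ : Measure E => ∫ x, f x ∂μ) =
      fun μ : Measure E => (∫⁻ x, ENNReal.ofReal (f x) ∂μ).toReal := by
    ext μ
    exact integral_eq_lintegral_of_nonneg_ae (.of_forall hf.nonneg)
      hf.measurable.aestronglyMeasurable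
  rw [this]
  exact (Measure.measurable_lintegral hf.measurable.ennreal_ofReal).ennreal_toReal

lemma IsBMPlus.lintegral_exp_neg_integral {f : E → ℝ} (hf : IsBMPlus f)
    (Q : Measure (Measure E)) [IsFiniteMeasure Q] :
    ∫⁻ μ, ENNReal.ofReal (Real.exp (-∫ x, f x ∂μ)) ∂Q =
      ENNReal.ofReal (laplaceFunctional Q f) := by
  have hm := hf.measurable_integral
  refine (ofReal_integral_eq_lintegral_ofReal ?_ (.of_forall fun μ => (Real.exp_pos _).le)).symm
  refine Integrable.of_bound (by fun_prop) 1 (.of_forall fun μ => ?_)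
  rw [Real.norm_of_nonneg (Real.exp_pos _).le]
  exact Real.exp_le_one_iff.2 (neg_nonpos.2 (integral_nonneg hf.nonneg))

omit [MetricSpace E] in
lemma measurable_measureReal_eval {A : Set E} (hA : MeasurableSet A) :
    Measurable fun μ : Measure E => μ.real A :=
  (Measure.measurable_coe hA).ennreal_toReal

lemma IsBoundedlyFinite.add {μ ν : Measure E} (hμ : IsBoundedlyFinite μ)
    (hν : IsBoundedlyFinite ν) : IsBoundedlyFinite (μ + ν) := fun s hs => by
  rw [Measure.add_apply]
  exact ENNReal.add_lt_top.2 ⟨hμ s hs, hν s hs⟩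

lemma IsBoundedlyFinite.sigmaFinite [BorelSpace E] {μ : Measure E} (hμ : IsBoundedlyFinite μ) :
    SigmaFinite μ := by
  rcases isEmpty_or_nonempty E with hE | ⟨⟨x⟩⟩
  · rw [Measure.eq_zero_of_isEmpty μ]; infer_instance
  · exact ⟨⟨⟨fun n : ℕ => Metric.ball x n, fun _ => trivial,
      fun n => hμ _ Metric.isBounded_ball, Metric.iUnion_ball_nat x⟩⟩⟩

omit [MetricSpace E] in
lemma integral_indicator_const_add_indicator_const {A B : Set E} (hA : MeasurableSet A)
    (hB : MeasurableSet B) {μ : Measure E} (hμA : μ A ≠ ∞) (hμB : μ B ≠ ∞) (u v : ℝ) :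
    ∫ x, (A.indicator (fun _ => u) x + B.indicator (fun _ => v) x) ∂μ =
      u * μ.real A + v * μ.real B := by
  rw [integral_add, integral_indicator_const _ hA, integral_indicator_const _ hB]
  · simp [mul_comm]
  · exact (integrable_indicator_iff hA).2 (integrableOn_const hμA)
  · exact (integrable_indicator_iff hB).2 (integrableOn_const hμB)

omit [MetricSpace E] in
-- The integrand is constant on each of the three disjoint pieces and vanishes outside `A ∪ B`,
-- since `log 1 = 0`.
lemma integral_log_one_add_indicator_add_indicator {A B : Set E} (hA : MeasurableSet A)
    (hB : MeasurableSet B) {μ : Measure E} (hμA : μ A ≠ ∞) (hμB : μ B ≠ ∞) (u v b : ℝ) :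
    ∫ x, Real.log (1 + (A.indicator (fun _ => u) x + B.indicator (fun _ => v) x) / b) ∂μ =
      μ.real (A \ B) * Real.log (1 + u / b) + μ.real (B \ A) * Real.log (1 + v / b)
        + μ.real (A ∩ B) * Real.log (1 + (u + v) / b) := by
  have h : ∀ x, Real.log (1 + (A.indicator (fun _ => u) x + B.indicator (fun _ => v) x) / b) =
      (A \ B).indicator (fun _ => Real.log (1 + u / b)) x
        + (B \ A).indicator (fun _ => Real.log (1 + v / b)) x
        + (A ∩ B).indicator (fun _ => Real.log (1 + (u + v) / b)) x := by
    intro x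
    by_cases hxA : x ∈ A <;> by_cases hxB : x ∈ B <;> simp [hxA, hxB]
  have hi : ∀ {C : Set E}, MeasurableSet C → μ C ≠ ∞ → ∀ a : ℝ,
      Integrable (C.indicator fun _ => a) μ := fun hC hμC a =>
    (integrable_indicator_iff hC).2 (integrableOn_const hμC)
  have h1 := measure_ne_top_of_subset (Set.sdiff_subset (s := A) (t := B)) hμA
  have h2 := measure_ne_top_of_subset (Set.sdiff_subset (s := B) (t := A)) hμB
  have h3 := measure_ne_top_of_subset (Set.inter_subset_left (s := A) (t := B)) hμA
  simp_rw [h]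
  rw [integral_add (by exact (hi (hA.diff hB) h1 _).add (hi (hB.diff hA) h2 _))
      (hi (hA.inter hB) h3 _),
    integral_add (hi (hA.diff hB) h1 _) (hi (hB.diff hA) h2 _),
    integral_indicator_const _ (hA.diff hB), integral_indicator_const _ (hB.diff hA),
    integral_indicator_const _ (hA.inter hB)]
  simp

/-- Along `s • 1_A` the exponent is `-H(A) log (1 + c s) - M(A) c s / (1 + c s)`, with slope `-c
(H(A) + M(A))` at 0. -/
lemma IsNoncentralGammaLaw.lintegral_apply {H M : Measure E} {c : ℝ} {Q : Measure (Measure E)}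
    (hQ : IsNoncentralGammaLaw H M c Q) (hc : 0 < c) (hH : IsBoundedlyFinite H)
    (hM : IsBoundedlyFinite M) {A : Set E} (hA : MeasurableSet A) (hb : Bornology.IsBounded A) :
    ∫⁻ μ, μ A ∂Q = ENNReal.ofReal c * (H A + M A) := by
  have := hQ.isProbabilityMeasure
  have hHA := (hH A hb).ne
  have hMA := (hM A hb).ne
  set ψ : ℝ → ℝ := fun s =>
    Real.exp (-(H.real A * Real.log (1 + c * s)) - M.real A * (c * s / (1 + c * s)))
  have hψ : ∀ s, 0 ≤ s → ∫⁻ μ, 1 * ENNReal.ofReal (Real.exp (-(s * μ.real A))) ∂Q =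
      ENNReal.ofReal (ψ s) := by
    intro s hs
    have hf := IsBMPlus.indicator_const hA hb hs
    have h1 : laplaceFunctional Q (A.indicator fun _ => s) = ψ s := by
      rw [hQ.laplace _ hf]
      have e1 : ∀ x, Real.log (1 + c * A.indicator (fun _ => s) x) =
          A.indicator (fun _ => Real.log (1 + c * s)) x := fun x => by
        by_cases hx : x ∈ A <;> simp [hx]
      have e2 : ∀ x, c * A.indicator (fun _ => s) x / (1 + c * A.indicator (fun _ => s) x) =
          A.indicator (fun _ => c * s / (1 + c * s)) x := fun x => by
        by_cases hx : x ∈ A <;> simp [hx]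
      simp_rw [e1, e2, integral_indicator_const _ hA, smul_eq_mul]
      rfl
    rw [← h1, ← hf.lintegral_exp_neg_integral]
    simp_rw [integral_indicator_const _ hA, one_mul, smul_eq_mul, mul_comm s]
  have hd : HasDerivAt ψ (-(c * (H.real A + M.real A))) 0 := by
    have e0 : HasDerivAt (fun s : ℝ => 1 + c * s) c 0 := by
      simpa using ((hasDerivAt_id (0 : ℝ)).const_mul c).const_add 1
    have e1 : HasDerivAt (fun s : ℝ => c * s) c 0 := by
      simpa using (hasDerivAt_id (0 : ℝ)).const_mul c
    have e2 := e0.log (by simp)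
    have e3 := e1.div e0 (by simp)
    have e4 := (((e2.const_mul (H.real A)).neg).sub (e3.const_mul (M.real A))).exp
    refine e4.congr_deriv ?_
    simp
    ring
  have key := lintegral_mul_ofReal_of_hasDerivWithinAt_laplace (P := Q) (Z := fun _ => 1)
    (X := fun μ => μ.real A) measurable_const (by simp) (measurable_measureReal_eval hA)
    (fun μ => measureReal_nonneg) hψ (fun s _ => (Real.exp_pos _).le) hd.hasDerivWithinAt
  have hae : ∀ᵐ μ ∂Q, μ A = 1 * ENNReal.ofReal (μ.real A) := by
    filter_upwards [hQ.boundedlyFinite] with μ hμ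
    rw [one_mul, ofReal_measureReal (hμ A hb).ne]
  rw [lintegral_congr_ae hae, key, neg_neg, ENNReal.ofReal_mul hc.le,
    ENNReal.ofReal_add measureReal_nonneg measureReal_nonneg, ofReal_measureReal hHA,
    ofReal_measureReal hMA]

lemma IsNoncentralGammaLaw.lintegral_lintegral [BorelSpace E] {H M : Measure E} {c : ℝ}
    {Q : Measure (Measure E)}
    (hQ : IsNoncentralGammaLaw H M c Q) (hc : 0 < c) (hH : IsBoundedlyFinite H)
    (hM : IsBoundedlyFinite M) {F : E → ℝ≥0∞} (hF : Measurable F) :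
    ∫⁻ μ, ∫⁻ x, F x ∂μ ∂Q = ENNReal.ofReal c * (∫⁻ x, F x ∂H + ∫⁻ x, F x ∂M) := by
  -- The mean measure of `Q` is identified on bounded sets; integrals of all functions follow at
  -- once.
  have h : Q.bind id = ENNReal.ofReal c • (H + M) := by
    refine Measure.ext_of_bounded fun A hA hb => ?_
    rw [Measure.bind_apply hA aemeasurable_id]
    simpa [mul_add] using hQ.lintegral_apply hc hH hM hA hb
  have h2 := Measure.lintegral_bind (m := Q) (μ := id) (f := F) aemeasurable_id hF.aemeasurable
  rw [h, lintegral_smul_measure, lintegral_add_measure] at h2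
  exact h2.symm

lemma IsGammaLaw.isNoncentralGammaLaw {H : Measure E} {b : ℝ} {Q : Measure (Measure E)}
    (hQ : IsGammaLaw H b Q) : IsNoncentralGammaLaw H 0 (1 / b) Q where
  isProbabilityMeasure := hQ.isProbabilityMeasure
  boundedlyFinite := hQ.boundedlyFinite
  laplace f hf := by
    rw [hQ.laplace f hf]
    simp [div_eq_inv_mul]

lemma IsGammaLaw.lintegral_lintegral [BorelSpace E] {H : Measure E} {b : ℝ}
    {Q : Measure (Measure E)} (hQ : IsGammaLaw H b Q) (hb : 0 < b) (hH : IsBoundedlyFinite H)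
    {F : E → ℝ≥0∞} (hF : Measurable F) :
    ∫⁻ μ, ∫⁻ x, F x ∂μ ∂Q = ENNReal.ofReal (1 / b) * ∫⁻ x, F x ∂H := by
  simpa using hQ.isNoncentralGammaLaw.lintegral_lintegral (by positivity) hH
    (fun s _ => by simp) hF

/-- The joint transform of the masses of `A` and `B` is differentiated in one variable at a time.
The factor `exp (-v μ(B))` is the weight in the first differentiation, and `μ(A)` is the weight in
the second. -/
lemma IsGammaLaw.lintegral_apply_mul_apply {H : Measure E} {b : ℝ} {Q : Measure (Measure E)}
    (hQ : IsGammaLaw H b Q) (hb : 0 < b) (hH : IsBoundedlyFinite H)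
    {A B : Set E} (hA : MeasurableSet A) (hAb : Bornology.IsBounded A)
    (hB : MeasurableSet B) (hBb : Bornology.IsBounded B) :
    ∫⁻ μ, μ A * μ B ∂Q = ENNReal.ofReal (1 / b ^ 2) * (H A * H B + H (A ∩ B)) := by
  have := hQ.isProbabilityMeasure
  have hHA := (hH A hAb).ne
  have hHB := (hH B hBb).ne
  set p := H.real (A \ B)
  set q := H.real (B \ A)
  set r := H.real (A ∩ B)
  have hp : 0 ≤ p := measureReal_nonneg
  have hr : 0 ≤ r := measureReal_nonneg
  set L : ℝ → ℝ → ℝ := fun u v => Real.exp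
    (-(p * Real.log (1 + u / b) + q * Real.log (1 + v / b) + r * Real.log (1 + (u + v) / b)))
  have hL : ∀ u v, 0 ≤ u → 0 ≤ v →
      ∫⁻ μ, ENNReal.ofReal (Real.exp (-(v * μ.real B))) *
        ENNReal.ofReal (Real.exp (-(u * μ.real A))) ∂Q = ENNReal.ofReal (L u v) := by
    intro u v hu hv
    have hf := (IsBMPlus.indicator_const hA hAb hu).add (IsBMPlus.indicator_const hB hBb hv)
    have h1 := hQ.laplace _ hf
    rw [integral_log_one_add_indicator_add_indicator hA hB hHA hHB] at h1
    rw [← show _ = L u v from h1, ← hf.lintegral_exp_neg_integral]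
    refine lintegral_congr_ae ?_
    filter_upwards [hQ.boundedlyFinite] with μ hμ
    rw [integral_indicator_const_add_indicator_const hA hB (hμ A hAb).ne (hμ B hBb).ne,
      ← ENNReal.ofReal_mul (Real.exp_pos _).le, ← Real.exp_add]
    ring_nf
  have hmA := measurable_measureReal_eval hA
  have hmB := measurable_measureReal_eval hB
  have hlin : ∀ v : ℝ, HasDerivAt (fun u : ℝ => 1 + u / b) (1 / b) v := fun v =>
    ((hasDerivAt_id v).div_const b).const_add 1
  -- This is `-∂L/∂u` at `u = 0`; `q` drops out because its term does not involve `u`.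
  set φ : ℝ → ℝ := fun v => L 0 v * (p / b + r / (b + v))
  have hfirst : ∀ v, 0 ≤ v →
      ∫⁻ μ, ENNReal.ofReal (μ.real A) * ENNReal.ofReal (Real.exp (-(v * μ.real B))) ∂Q =
        ENNReal.ofReal (φ v) := by
    intro v hv
    have hd : HasDerivAt (fun u => L u v) (-φ v) 0 := by
      have hv' : 1 + v / b ≠ 0 := by positivity
      have e1 := ((hlin 0).log (by simp)).const_mul p
      have e2 : HasDerivAt (fun u : ℝ => 1 + (u + v) / b) (1 / b) 0 :=
        (((hasDerivAt_id (0 : ℝ)).add_const v).div_const b).const_add 1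
      have e3 := (e2.log (by simpa using hv')).const_mul r
      have e4 := (((e1.add_const (q * Real.log (1 + v / b))).add e3).neg).exp
      refine e4.congr_deriv ?_
      have : b + v ≠ 0 := by positivity
      have hinv : b⁻¹ / (1 + v / b) = 1 / (b + v) := by field_simp
      simp only [φ, L]
      simp [hinv]
      ring
    have key := lintegral_mul_ofReal_of_hasDerivWithinAt_laplace (P := Q)
      (Z := fun μ => ENNReal.ofReal (Real.exp (-(v * μ.real B))))
      (X := fun μ => μ.real A) (by fun_prop) (by simp) hmA
      (fun μ => measureReal_nonneg) (fun u hu => hL u v hu hv)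
      (fun u _ => (Real.exp_pos _).le) hd.hasDerivWithinAt
    rw [neg_neg] at key
    rw [← key]
    simp_rw [mul_comm]
  have hd : HasDerivAt φ (-(1 / b ^ 2 * ((p + r) * (q + r) + r))) 0 := by
    have e1 := ((hlin 0).log (by simp)).const_mul q
    have e2 : HasDerivAt (fun u : ℝ => 1 + (0 + u) / b) (1 / b) 0 := by simpa using hlin 0
    have e3 := (e2.log (by simp)).const_mul r
    have e4 := (((e1.const_add (p * Real.log (1 + 0 / b))).add e3).neg).exp
    have e5 : HasDerivAt (fun v : ℝ => b + v) 1 0 := (hasDerivAt_id (0 : ℝ)).const_add b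
    have e6 := (((hasDerivAt_const (0 : ℝ) r).div e5 (by simpa using hb.ne')).const_add (p / b))
    refine (e4.mul e6).congr_deriv ?_
    simp
    field_simp
    ring
  have key := lintegral_mul_ofReal_of_hasDerivWithinAt_laplace (P := Q)
    (Z := fun μ => ENNReal.ofReal (μ.real A)) (X := fun μ => μ.real B) (by fun_prop) (by simp) hmB
    (fun μ => measureReal_nonneg) hfirst
    (fun v hv => mul_nonneg (Real.exp_pos _).le (by positivity)) hd.hasDerivWithinAt
  have hae : ∀ᵐ μ ∂Q, μ A * μ B = ENNReal.ofReal (μ.real A) * ENNReal.ofReal (μ.real B) := by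
    filter_upwards [hQ.boundedlyFinite] with μ hμ
    rw [ofReal_measureReal (hμ A hAb).ne, ofReal_measureReal (hμ B hBb).ne]
  have hpA : p + r = H.real A := by
    rw [add_comm]; exact measureReal_inter_add_sdiff hB hHA
  have hqB : q + r = H.real B := by
    rw [add_comm]
    simp only [r, q, Set.inter_comm A B]
    exact measureReal_inter_add_sdiff hA hHB
  rw [lintegral_congr_ae hae, key, neg_neg, hpA, hqB, ENNReal.ofReal_mul (by positivity),
    ENNReal.ofReal_add (by positivity) hr, ENNReal.ofReal_mul measureReal_nonneg,
    ofReal_measureReal hHA, ofReal_measureReal hHB,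
    ofReal_measureReal (measure_ne_top_of_subset Set.inter_subset_left hHA)]

omit [MetricSpace E] in
-- With `G` fixed, the second moment is the integral of `F` against a single measure, so bilinear
-- identities can be checked on sets.
lemma lintegral_bind_withDensity {Q : Measure (Measure E)} {G F : E → ℝ≥0∞} (hG : Measurable G)
    (hF : Measurable F) :
    ∫⁻ x, F x ∂((Q.withDensity fun μ => ∫⁻ x, G x ∂μ).bind id) =
      ∫⁻ μ, (∫⁻ x, G x ∂μ) * (∫⁻ x, F x ∂μ) ∂Q := by
  rw [Measure.lintegral_bind aemeasurable_id hF.aemeasurable,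
    lintegral_withDensity_eq_lintegral_mul _ (Measure.measurable_lintegral hG)
      (by exact Measure.measurable_lintegral hF)]
  rfl

lemma IsGammaLaw.lintegral_lintegral_mul_lintegral [BorelSpace E] {H : Measure E} {b : ℝ}
    {Q : Measure (Measure E)} (hQ : IsGammaLaw H b Q) (hb : 0 < b) (hH : IsBoundedlyFinite H)
    {F G : E → ℝ≥0∞} (hF : Measurable F) (hG : Measurable G) :
    ∫⁻ μ, (∫⁻ x, F x ∂μ) * (∫⁻ x, G x ∂μ) ∂Q =
      ENNReal.ofReal (1 / b ^ 2) * ((∫⁻ x, F x ∂H) * (∫⁻ x, G x ∂H) + ∫⁻ x, F x * G x ∂H) := by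
  -- For fixed `F`, validity against bounded sets implies validity against every `G`. It is used
  -- twice: with `F` an indicator, and then, after exchanging the factors, with general `F`.
  have step : ∀ {F : E → ℝ≥0∞}, Measurable F →
      (∀ A, MeasurableSet A → Bornology.IsBounded A →
        ∫⁻ μ, (∫⁻ x, F x ∂μ) * μ A ∂Q =
          ENNReal.ofReal (1 / b ^ 2) * ((∫⁻ x, F x ∂H) * H A + ∫⁻ x in A, F x ∂H)) →
      ∀ {G : E → ℝ≥0∞}, Measurable G →
        ∫⁻ μ, (∫⁻ x, F x ∂μ) * (∫⁻ x, G x ∂μ) ∂Q = ENNReal.ofReal (1 / b ^ 2) *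
          ((∫⁻ x, F x ∂H) * (∫⁻ x, G x ∂H) + ∫⁻ x, F x * G x ∂H) := by
    intro F hF h G hG
    have e : (Q.withDensity fun μ => ∫⁻ x, F x ∂μ).bind id =
        ENNReal.ofReal (1 / b ^ 2) • ((∫⁻ x, F x ∂H) • H + H.withDensity F) := by
      refine Measure.ext_of_bounded fun A hA hAb => ?_
      have h1 := lintegral_bind_withDensity (Q := Q) hF (measurable_one.indicator hA)
      simp only [lintegral_indicator_one hA] at h1
      rw [h1, h A hA hAb]
      simp [withDensity_apply _ hA, mul_add]
    rw [← lintegral_bind_withDensity hF hG, e, lintegral_smul_measure, lintegral_add_measure,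
      lintegral_smul_measure, lintegral_withDensity_eq_lintegral_mul _ hF hG]
    rfl
  refine step hF (fun A hA hAb => ?_) hG
  have h1 := step (F := A.indicator 1) (measurable_one.indicator hA) (fun B hB hBb => ?_) hF
  · simp_rw [lintegral_indicator_one hA] at h1
    calc ∫⁻ μ, (∫⁻ x, F x ∂μ) * μ A ∂Q
        = ∫⁻ μ, μ A * ∫⁻ x, F x ∂μ ∂Q := lintegral_congr fun μ => mul_comm _ _
      _ = _ := by
        rw [h1, mul_comm (H A), ← lintegral_indicator hA]
        congr 3 with x
        by_cases hx : x ∈ A <;> simp [hx]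
  · simp_rw [lintegral_indicator_one hA]
    rw [hQ.lintegral_apply_mul_apply hb hH hA hAb hB hBb, Measure.restrict_apply hA]

end RandomMeasure

/-! ### Stationarity and lagged moments of the M-ARG(1) process -/

section MARG

/-- Countably many balls suffice as tests. Measurability lets almost sure bounded finiteness pass to
the image law. -/
lemma measurableSet_isBoundedlyFinite {E : Type*} [MetricSpace E] [MeasurableSpace E]
    [BorelSpace E] : MeasurableSet {μ : Measure E | IsBoundedlyFinite μ} := by
  rcases isEmpty_or_nonempty E with hE | ⟨⟨x⟩⟩
  · convert MeasurableSet.univ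
    ext μ
    simp [IsBoundedlyFinite, Measure.eq_zero_of_isEmpty μ]
  · have : {μ : Measure E | IsBoundedlyFinite μ} = ⋂ n : ℕ, {μ | μ (Metric.ball x n) < ∞} := by
      ext μ
      simp only [Set.mem_ofPred_eq, Set.mem_iInter]
      refine ⟨fun h n => h _ Metric.isBounded_ball, fun h s hs => ?_⟩
      obtain ⟨r, hr⟩ := hs.subset_ball x
      obtain ⟨n, hn⟩ := exists_nat_ge r
      exact (measure_mono (hr.trans (Metric.ball_subset_ball hn))).trans_lt (h n)
    rw [this]
    exact .iInter fun n => measurableSet_lt (Measure.measurable_coe measurableSet_ball)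
      measurable_const

variable {Θ Ω : Type*} [MetricSpace Θ] [MeasurableSpace Θ] [BorelSpace Θ] [MeasurableSpace Ω]
  {P : Measure Ω} [IsProbabilityMeasure P] {H : Measure Θ} {β c : ℕ → ℝ} {W : ℕ → Ω → Measure Θ}

omit [BorelSpace Θ] [IsProbabilityMeasure P] in
lemma IsMARG.measurable_lintegral (hW : IsMARG P H β c W) {t : ℕ} (ht : 1 ≤ t) {F : Θ → ℝ≥0∞}
    (hF : Measurable F) : Measurable fun ω => ∫⁻ θ, F θ ∂(W t ω) :=
  (Measure.measurable_lintegral hF).comp (hW.measurable t ht)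

/-- The conditional mean of `W (t + 1)` given the past is affine in `W t`. -/
lemma IsMARG.lintegral_mul_lintegral_succ (hW : IsMARG P H β c W) {t : ℕ} (ht : 1 ≤ t)
    {Z : (Set.Icc 1 t → Measure Θ) → ℝ≥0∞} (hZ : Measurable Z) {G : Θ → ℝ≥0∞} (hG : Measurable G) :
    ∫⁻ ω, Z (fun s => W s ω) * ∫⁻ θ, G θ ∂(W (t + 1) ω) ∂P =
      ∫⁻ ω, Z (fun s => W s ω) * (ENNReal.ofReal (c (t + 1)) *
        (∫⁻ θ, G θ ∂H + ENNReal.ofReal (β (t + 1)) * ∫⁻ θ, G θ ∂(W t ω))) ∂P := by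
  obtain ⟨κ, _, hκ, hκW⟩ := hW.transition t ht
  have hG' := Measure.measurable_lintegral hG
  rw [lintegral_prod_mk_of_hasCondDistrib (F := fun w μ => Z w * ∫⁻ θ, G θ ∂μ) hκ (by fun_prop)]
  refine lintegral_congr_ae ?_
  filter_upwards [hκW, hW.boundedlyFinite t ht] with ω h1 h2
  have h3 : IsBoundedlyFinite (ENNReal.ofReal (β (t + 1)) • W t ω) := fun s hs => by
    simpa using ENNReal.mul_lt_top ENNReal.ofReal_lt_top (h2 s hs)
  rw [lintegral_const_mul _ hG']
  simp only [Kernel.comap_apply]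
  rw [h1.lintegral_lintegral (hW.c_pos _ (by omega)) hW.base h3 hG, lintegral_smul_measure]
  rfl

/-- One step of the M-ARG(1) process with parameters `β, c` preserves the law
`GaP(H, (1 - β c) / c)`. -/
lemma IsMARG.isGammaLaw_succ (hW : IsMARG P H β c W) {t : ℕ} (ht : 1 ≤ t)
    (hρ : β (t + 1) * c (t + 1) < 1)
    (hQ : IsGammaLaw H ((1 - β (t + 1) * c (t + 1)) / c (t + 1)) (P.map (W t))) :
    IsGammaLaw H ((1 - β (t + 1) * c (t + 1)) / c (t + 1)) (P.map (W (t + 1))) := by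
  have hm := hW.measurable t ht
  have hm' := hW.measurable (t + 1) (by omega)
  have := Measure.isProbabilityMeasure_map (μ := P) hm.aemeasurable
  have hprob := Measure.isProbabilityMeasure_map (μ := P) hm'.aemeasurable
  refine ⟨hprob, ?_, fun f hf => ?_⟩
  · rw [ae_map_iff hm'.aemeasurable measurableSet_isBoundedlyFinite]
    exact hW.boundedlyFinite _ (by omega)
  have hβ := hW.β_pos (t + 1) (by omega)
  have hc := hW.c_pos (t + 1) (by omega)
  obtain ⟨κ, _, hκ, hκW⟩ := hW.transition t ht
  set b₀ := β (t + 1)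
  set c₀ := c (t + 1)
  -- Conditioning on `W t` turns the test function `f` into `β c f / (1 + c f)`, which is again in
  -- the class.
  have hg := (hf.mul_div_one_add_mul hc.le).const_mul hβ.le
  have hlog := hf.log_one_add_mul hc.le
  have hmf := hf.measurable_integral
  have hmg := hg.measurable_integral
  have h1 : ENNReal.ofReal (laplaceFunctional (P.map (W (t + 1))) f) =
      ENNReal.ofReal (Real.exp (-∫ x, Real.log (1 + c₀ * f x) ∂H)) *
        ENNReal.ofReal (laplaceFunctional (P.map (W t))
          fun x => b₀ * (c₀ * f x / (1 + c₀ * f x))) := by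
    rw [← hf.lintegral_exp_neg_integral, ← hg.lintegral_exp_neg_integral,
      lintegral_map (by fun_prop) hm', lintegral_map (by fun_prop) hm,
      ← lintegral_const_mul _ (by fun_prop),
      lintegral_prod_mk_of_hasCondDistrib (F := fun _ μ =>
        ENNReal.ofReal (Real.exp (-∫ x, f x ∂μ))) hκ (by fun_prop)]
    refine lintegral_congr_ae ?_
    filter_upwards [hκW] with ω h
    have := h.isProbabilityMeasure
    simp only [Kernel.comap_apply]
    rw [hf.lintegral_exp_neg_integral, h.laplace f hf, ← ENNReal.ofReal_mul (Real.exp_pos _).le,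
      ← Real.exp_add, integral_smul_measure, ENNReal.toReal_ofReal hβ.le, integral_const_mul]
    rfl
  rw [hQ.laplace _ hg, ← ENNReal.ofReal_mul (Real.exp_pos _).le, ← Real.exp_add] at h1
  have h2 : laplaceFunctional (P.map (W (t + 1))) f = _ := (ENNReal.ofReal_eq_ofReal_iff (integral_nonneg fun μ => (Real.exp_pos _).le)
    (Real.exp_pos _).le).1 h1
  have hb : 0 < (1 - b₀ * c₀) / c₀ := div_pos (by linarith) hc
  have hlog' := hg.log_one_add_mul (inv_pos.2 hb).le
  simp_rw [inv_mul_eq_div] at hlog'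
  rw [h2, ← neg_add, ← integral_add (hlog.integrable hW.base) (hlog'.integrable hW.base)]
  congr 2
  -- With `ρ = β c`, the arguments multiply as `(1 + c f) (1 + (ρ f / (1 + c f)) c / (1 - ρ)) = 1 +
  -- c f / (1 - ρ)`.
  refine integral_congr_ae (.of_forall fun x => ?_)
  have hx := hf.nonneg x
  have e1 : 0 < 1 + c₀ * f x := by positivity
  have e2 : 0 < 1 + b₀ * (c₀ * f x / (1 + c₀ * f x)) / ((1 - b₀ * c₀) / c₀) := by positivity
  have e3 : 1 - c₀ * b₀ ≠ 0 := by linarith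
  simp only
  rw [← Real.log_mul e1.ne' e2.ne']
  congr 1
  field_simp
  ring

lemma CondH4.isGammaLaw {b₀ c₀ ρ : ℝ} (h4 : CondH4 P H β c b₀ c₀ ρ (W 1))
    (hW : IsMARG P H β c W) {t : ℕ} (ht : 1 ≤ t) :
    IsGammaLaw H ((1 - ρ) / c₀) (P.map (W t)) := by
  induction t, ht using Nat.le_induction with
  | base => exact h4.initial
  | succ t ht ih =>
    have hβ := h4.β_const (t + 1) (by omega)
    have hc := h4.c_const (t + 1) (by omega)
    have hρ := h4.ρ_lt_one
    have := hW.isGammaLaw_succ ht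
    rw [hβ, hc, ← h4.ρ_eq] at this
    exact this hρ ih

omit [BorelSpace Θ] [IsProbabilityMeasure P] in
lemma CondH4.c_pos {b₀ c₀ ρ : ℝ} (h4 : CondH4 P H β c b₀ c₀ ρ (W 1))
    (hW : IsMARG P H β c W) : 0 < c₀ := h4.c_const 2 le_rfl ▸ hW.c_pos 2 le_rfl

omit [BorelSpace Θ] [IsProbabilityMeasure P] in
lemma CondH4.β_pos {b₀ c₀ ρ : ℝ} (h4 : CondH4 P H β c b₀ c₀ ρ (W 1))
    (hW : IsMARG P H β c W) : 0 < b₀ := h4.β_const 2 le_rfl ▸ hW.β_pos 2 le_rfl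

omit [BorelSpace Θ] [IsProbabilityMeasure P] in
lemma CondH4.ρ_pos {b₀ c₀ ρ : ℝ} (h4 : CondH4 P H β c b₀ c₀ ρ (W 1))
    (hW : IsMARG P H β c W) : 0 < ρ :=
  h4.ρ_eq ▸ mul_pos (h4.β_pos hW) (h4.c_pos hW)

lemma CondH4.lintegral_lintegral {b₀ c₀ ρ : ℝ} (h4 : CondH4 P H β c b₀ c₀ ρ (W 1))
    (hW : IsMARG P H β c W) {t : ℕ} (ht : 1 ≤ t) {F : Θ → ℝ≥0∞} (hF : Measurable F) :
    ∫⁻ ω, ∫⁻ θ, F θ ∂(W t ω) ∂P = ENNReal.ofReal (c₀ / (1 - ρ)) * ∫⁻ θ, F θ ∂H := by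
  have h := (h4.isGammaLaw hW ht).lintegral_lintegral
    (div_pos (sub_pos.2 h4.ρ_lt_one) (h4.c_pos hW)) hW.base hF
  rwa [lintegral_map (Measure.measurable_lintegral hF) (hW.measurable t ht), one_div_div] at h

/-- The lagged second moments of a stationary M-ARG(1) process. -/
lemma CondH4.lintegral_mul_lintegral {b₀ c₀ ρ : ℝ} (h4 : CondH4 P H β c b₀ c₀ ρ (W 1))
    (hW : IsMARG P H β c W) {t : ℕ} (ht : 1 ≤ t) (h : ℕ) {F G : Θ → ℝ≥0∞} (hF : Measurable F)
    (hG : Measurable G) :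
    ∫⁻ ω, (∫⁻ θ, F θ ∂(W t ω)) * (∫⁻ θ, G θ ∂(W (t + h) ω)) ∂P =
      ENNReal.ofReal ((c₀ / (1 - ρ)) ^ 2) * ((∫⁻ θ, F θ ∂H) * (∫⁻ θ, G θ ∂H)
        + ENNReal.ofReal (ρ ^ h) * ∫⁻ θ, F θ * G θ ∂H) := by
  have hc := h4.c_pos hW
  have hβ := h4.β_pos hW
  have hρ := h4.ρ_pos hW
  have hρ1 : 0 < 1 - ρ := sub_pos.2 h4.ρ_lt_one
  have hmF := hW.measurable_lintegral ht hF
  induction h with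
  | zero =>
    have h := (h4.isGammaLaw hW ht).lintegral_lintegral_mul_lintegral (div_pos hρ1 hc) hW.base hF hG
    rw [lintegral_map (by exact (Measure.measurable_lintegral hF).mul (Measure.measurable_lintegral hG))
      (hW.measurable t ht), ← one_div_pow, one_div_div] at h
    simpa using h
  | succ h ih =>
    have hmG := hW.measurable_lintegral (t := t + h) (by omega) hG
    -- The functional of `W t` depends on the past up to `t + h`, so it can serve as the weight when
    -- conditioning.
    have hm : Measurable fun w : Set.Icc 1 (t + h) → Measure Θ =>
        ∫⁻ θ, F θ ∂(w ⟨t, ht, by omega⟩) :=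
      (Measure.measurable_lintegral hF).comp (measurable_pi_apply _)
    have h1 := hW.lintegral_mul_lintegral_succ (t := t + h) (by omega) hm hG
    rw [h4.c_const _ (by omega), h4.β_const _ (by omega)] at h1
    rw [← add_assoc, h1]
    have h2 : ∀ ω, (∫⁻ θ, F θ ∂(W t ω)) * (ENNReal.ofReal c₀ *
        (∫⁻ θ, G θ ∂H + ENNReal.ofReal b₀ * ∫⁻ θ, G θ ∂(W (t + h) ω))) =
        (ENNReal.ofReal c₀ * ∫⁻ θ, G θ ∂H) * (∫⁻ θ, F θ ∂(W t ω)) + ENNReal.ofReal ρ *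
          ((∫⁻ θ, F θ ∂(W t ω)) * ∫⁻ θ, G θ ∂(W (t + h) ω)) := fun ω => by
      rw [h4.ρ_eq, ENNReal.ofReal_mul hβ.le]
      ring
    simp_rw [h2]
    rw [lintegral_add_left (by fun_prop), lintegral_const_mul _ hmF,
      lintegral_const_mul _ (by fun_prop), ih, h4.lintegral_lintegral hW ht hF, pow_succ ρ h,
      ENNReal.ofReal_mul (by positivity)]
    -- For `m = c₀ / (1 - ρ)` this is `c₀ m + ρ m² = m²`, so the product-of-means term is unchanged
    -- by a step.
    have h3 : ENNReal.ofReal c₀ * ENNReal.ofReal (c₀ / (1 - ρ))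
        + ENNReal.ofReal ρ * ENNReal.ofReal ((c₀ / (1 - ρ)) ^ 2) =
        ENNReal.ofReal ((c₀ / (1 - ρ)) ^ 2) := by
      rw [← ENNReal.ofReal_mul hc.le, ← ENNReal.ofReal_mul hρ.le,
        ← ENNReal.ofReal_add (by positivity) (by positivity)]
      congr 1
      field_simp
      ring
    calc _ = (ENNReal.ofReal c₀ * ENNReal.ofReal (c₀ / (1 - ρ))
          + ENNReal.ofReal ρ * ENNReal.ofReal ((c₀ / (1 - ρ)) ^ 2)) *
            ((∫⁻ θ, F θ ∂H) * (∫⁻ θ, G θ ∂H)) + ENNReal.ofReal ((c₀ / (1 - ρ)) ^ 2) *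
            (ENNReal.ofReal (ρ ^ h) * ENNReal.ofReal ρ * ∫⁻ θ, F θ * G θ ∂H) := by ring
      _ = _ := by rw [h3]; ring

end MARG

/-! ### Poisson moments conditionally on the driving process -/

section Cox

lemma IsPoissonLaw.lintegral_apply {E : Type*} [MeasurableSpace E] {L : Measure E}
    {Q : Measure (Measure E)} (hQ : IsPoissonLaw L Q) {B : Set E} (hB : MeasurableSet B) :
    ∫⁻ μ, μ B ∂Q = L B := by
  rw [← lintegral_id_extendedPoisson (L B), ← hQ.count B hB,
    lintegral_map (by fun_prop) (Measure.measurable_coe hB)]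

lemma IsPoissonLaw.lintegral_apply_mul_self {E : Type*} [MeasurableSpace E] {L : Measure E}
    {Q : Measure (Measure E)} (hQ : IsPoissonLaw L Q) {B : Set E} (hB : MeasurableSet B) :
    ∫⁻ μ, μ B * μ B ∂Q = L B * L B + L B := by
  rw [← lintegral_sq_extendedPoisson (L B), ← hQ.count B hB,
    lintegral_map (by fun_prop) (Measure.measurable_coe hB)]

lemma IsPoissonLaw.lintegral_apply_mul_of_disjoint {E : Type*} [MeasurableSpace E] {L : Measure E}
    {Q : Measure (Measure E)} (hQ : IsPoissonLaw L Q) {A B : Set E} (hA : MeasurableSet A)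
    (hB : MeasurableSet B) (hAB : Disjoint A B) :
    ∫⁻ μ, μ A * μ B ∂Q = L A * L B := by
  have h := hQ.indep 2 ![A, B] (by simp [Fin.forall_fin_two, hA, hB]) (by
    intro i j hij
    fin_cases i <;> fin_cases j <;> simp_all [disjoint_comm])
  have h2 := h.indepFun (i := 0) (j := 1) (by decide)
  simp only [Matrix.cons_val_zero, Matrix.cons_val_one] at h2
  have h3 := lintegral_mul_eq_lintegral_mul_lintegral_of_indepFun (Measure.measurable_coe hA)
    (Measure.measurable_coe hB) h2
  rw [hQ.lintegral_apply hA, hQ.lintegral_apply hB] at h3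
  exact h3

/-- Splitting along `A ∩ B` leaves products over disjoint sets, which factor, and one square, which
produces the diagonal term. No subtraction occurs, so infinite masses are allowed. -/
lemma IsPoissonLaw.lintegral_apply_mul_apply {E : Type*} [MeasurableSpace E] {L : Measure E}
    {Q : Measure (Measure E)} (hQ : IsPoissonLaw L Q) {A B : Set E} (hA : MeasurableSet A)
    (hB : MeasurableSet B) :
    ∫⁻ μ, μ A * μ B ∂Q = L A * L B + L (A ∩ B) := by
  have e1 : ∀ μ : Measure E, μ A = μ (A ∩ B) + μ (A \ B) := fun μ =>
    (measure_inter_add_sdiff A hB).symm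
  have e2 : ∀ μ : Measure E, μ B = μ (A ∩ B) + μ (B \ A) := fun μ => by
    rw [Set.inter_comm]; exact (measure_inter_add_sdiff B hA).symm
  have hI := hA.inter hB
  have hD := hA.diff hB
  have hD' := hB.diff hA
  have mI := Measure.measurable_coe hI
  have mD' := Measure.measurable_coe hD'
  have h : ∀ μ : Measure E, μ A * μ B = μ (A ∩ B) * μ (A ∩ B) + μ (A ∩ B) * μ (B \ A)
      + μ (A \ B) * μ B := fun μ => by rw [e1, e2 μ]; ring
  simp_rw [h]
  rw [lintegral_add_left (by exact (mI.mul mI).add (mI.mul mD')),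
    lintegral_add_left (by exact mI.mul mI), hQ.lintegral_apply_mul_self hI,
    hQ.lintegral_apply_mul_of_disjoint hI hD'
      (Set.disjoint_sdiff_right.mono_left Set.inter_subset_left),
    hQ.lintegral_apply_mul_of_disjoint hD hB Set.disjoint_sdiff_left]
  ring

variable {Θ Y Ω : Type*} [MetricSpace Θ] [MeasurableSpace Θ] [MeasurableSpace Y]
  [MeasurableSpace Ω] {P : Measure Ω} [IsProbabilityMeasure P]
  {H : Measure Θ} {β c : ℕ → ℝ} {l : Measure Y} {K : Y → Θ → ℝ≥0} {k : ℕ → ℝ≥0}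
  {W : ℕ → Ω → Measure Θ} {N : ℕ → Ω → Measure Y}

lemma IsSNMARG.lintegral_apply (hN : IsSNMARG P H β c l K k W N) {t : ℕ} (ht : 1 ≤ t)
    {B : Set Y} (hB : MeasurableSet B) :
    ∫⁻ ω, N t ω B ∂P = ∫⁻ ω, shotNoiseIntensity l K (k t) (W t ω) B ∂P := by
  obtain ⟨κ, _, hκ, hκW⟩ := hN.cox
  have hmB := Measure.measurable_coe hB
  rw [lintegral_prod_mk_of_hasCondDistrib (F := fun _ n => n ⟨t, ht⟩ B) hκ
    (hmB.comp ((measurable_pi_apply _).comp measurable_snd))]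
  refine lintegral_congr_ae ?_
  filter_upwards [hκW] with ω hω
  have h := (hω.2 ⟨t, ht⟩).lintegral_apply hB
  rwa [lintegral_map hmB (by fun_prop)] at h

lemma IsSNMARG.lintegral_apply_mul_apply (hN : IsSNMARG P H β c l K k W N) {t : ℕ} (ht : 1 ≤ t)
    {A B : Set Y} (hA : MeasurableSet A) (hB : MeasurableSet B) :
    ∫⁻ ω, N t ω A * N t ω B ∂P = ∫⁻ ω, (shotNoiseIntensity l K (k t) (W t ω) A *
      shotNoiseIntensity l K (k t) (W t ω) B + shotNoiseIntensity l K (k t) (W t ω) (A ∩ B)) ∂P := by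
  obtain ⟨κ, _, hκ, hκW⟩ := hN.cox
  have hmA := Measure.measurable_coe hA
  have hmB := Measure.measurable_coe hB
  rw [lintegral_prod_mk_of_hasCondDistrib (F := fun _ n => n ⟨t, ht⟩ A * n ⟨t, ht⟩ B) hκ
    ((hmA.mul hmB).comp ((measurable_pi_apply _).comp measurable_snd))]
  refine lintegral_congr_ae ?_
  filter_upwards [hκW] with ω hω
  have h := (hω.2 ⟨t, ht⟩).lintegral_apply_mul_apply hA hB
  rwa [lintegral_map (by exact hmA.mul hmB) (by fun_prop)] at h

/-- At distinct times conditional independence factors the moment, so no diagonal term appears. -/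
lemma IsSNMARG.lintegral_apply_mul_apply_of_ne (hN : IsSNMARG P H β c l K k W N) {s t : ℕ}
    (hs : 1 ≤ s) (ht : 1 ≤ t) (hst : s ≠ t)
    {A B : Set Y} (hA : MeasurableSet A) (hB : MeasurableSet B) :
    ∫⁻ ω, N s ω A * N t ω B ∂P = ∫⁻ ω, shotNoiseIntensity l K (k s) (W s ω) A *
      shotNoiseIntensity l K (k t) (W t ω) B ∂P := by
  obtain ⟨κ, _, hκ, hκW⟩ := hN.cox
  have hmA := Measure.measurable_coe hA
  have hmB := Measure.measurable_coe hB
  rw [lintegral_prod_mk_of_hasCondDistrib (F := fun _ n => n ⟨s, hs⟩ A * n ⟨t, ht⟩ B) hκ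
    ((hmA.comp ((measurable_pi_apply (⟨s, hs⟩ : Set.Ici 1)).comp measurable_snd)).mul
      (hmB.comp ((measurable_pi_apply (⟨t, ht⟩ : Set.Ici 1)).comp measurable_snd)))]
  refine lintegral_congr_ae ?_
  filter_upwards [hκW] with ω hω
  have h1 := (hω.2 ⟨s, hs⟩).lintegral_apply hA
  have h2 := (hω.2 ⟨t, ht⟩).lintegral_apply hB
  rw [lintegral_map hmA (by fun_prop)] at h1
  rw [lintegral_map hmB (by fun_prop)] at h2
  have hind := (hω.1.indepFun (i := ⟨s, hs⟩) (j := ⟨t, ht⟩) (by simpa [Subtype.ext_iff] using hst)).comp hmA hmB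
  rw [← h1, ← h2]
  exact lintegral_mul_eq_lintegral_mul_lintegral_of_indepFun
    (hmA.comp (measurable_pi_apply _)) (hmB.comp (measurable_pi_apply _)) hind

/-! ### Shot noise intensities and moments of the SN-M-ARG(1) process -/

omit [MetricSpace Θ] in
lemma measurable_kernelMass [SFinite l] (hK : Measurable (Function.uncurry K)) (B : Set Y) :
    Measurable (kernelMass l K B) :=
  (hK.coe_nnreal_ennreal.comp measurable_swap).lintegral_prod_right'

omit [MetricSpace Θ] in
lemma setLIntegral_lintegral_eq_lintegral_kernelMass [SFinite l]
    (hK : Measurable (Function.uncurry K)) (w : Measure Θ) [SFinite w] (B : Set Y) :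
    ∫⁻ y in B, ∫⁻ θ, K y θ ∂w ∂l = ∫⁻ θ, kernelMass l K B θ ∂w :=
  lintegral_lintegral_swap hK.coe_nnreal_ennreal.aemeasurable

omit [MetricSpace Θ] in
lemma shotNoiseIntensity_apply [SFinite l] (hK : Measurable (Function.uncurry K))
    (a : ℝ≥0) (w : Measure Θ) [SFinite w] {B : Set Y} (hB : MeasurableSet B) :
    shotNoiseIntensity l K a w B = a * ∫⁻ θ, kernelMass l K B θ ∂w := by
  rw [shotNoiseIntensity, Measure.smul_apply, withDensity_apply _ hB,
    setLIntegral_lintegral_eq_lintegral_kernelMass hK]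
  rfl

omit [IsProbabilityMeasure P] in
-- Bounded finiteness makes `W t ω` σ-finite, which permits Tonelli. The exceptional null set does
-- not depend on `B`.
lemma IsMARG.shotNoiseIntensity_apply [BorelSpace Θ] [SFinite l] (hW : IsMARG P H β c W)
    (hK : Measurable (Function.uncurry K)) (a : ℝ≥0) {t : ℕ} (ht : 1 ≤ t) :
    ∀ᵐ ω ∂P, ∀ B, MeasurableSet B →
      shotNoiseIntensity l K a (W t ω) B = a * ∫⁻ θ, kernelMass l K B θ ∂(W t ω) := by
  filter_upwards [hW.boundedlyFinite t ht] with ω hω B hB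
  have := hω.sigmaFinite
  exact _root_.shotNoiseIntensity_apply hK a _ hB

/-- The means of a stationary SN-M-ARG(1) process. -/
lemma IsSNMARG.lintegral_apply_of_condH4 [BorelSpace Θ] [SFinite l]
    (hN : IsSNMARG P H β c l K k W N) (hK : Measurable (Function.uncurry K))
    {b₀ c₀ ρ : ℝ} (h4 : CondH4 P H β c b₀ c₀ ρ (W 1)) {t : ℕ} (ht : 1 ≤ t)
    {B : Set Y} (hB : MeasurableSet B) :
    ∫⁻ ω, N t ω B ∂P =
      k t * (ENNReal.ofReal (c₀ / (1 - ρ)) * ∫⁻ θ, kernelMass l K B θ ∂H) := by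
  have hKB := measurable_kernelMass (l := l) hK B
  rw [hN.lintegral_apply ht hB, ← h4.lintegral_lintegral hN.marg ht hKB,
    ← lintegral_const_mul _ (hN.marg.measurable_lintegral ht hKB)]
  refine lintegral_congr_ae ?_
  filter_upwards [hN.marg.shotNoiseIntensity_apply (l := l) hK (k t) ht] with ω hω
  exact hω B hB

/-- The second moments of a stationary SN-M-ARG(1) process. -/
lemma IsSNMARG.lintegral_apply_mul_apply_of_condH4 [BorelSpace Θ] [SFinite l]
    (hN : IsSNMARG P H β c l K k W N) (hK : Measurable (Function.uncurry K))
    {b₀ c₀ ρ : ℝ} (h4 : CondH4 P H β c b₀ c₀ ρ (W 1)) {t : ℕ} (ht : 1 ≤ t) (h : ℕ)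
    {A B : Set Y} (hA : MeasurableSet A) (hB : MeasurableSet B) :
    ∫⁻ ω, N t ω A * N (t + h) ω B ∂P =
      k t * k (t + h) * (ENNReal.ofReal ((c₀ / (1 - ρ)) ^ 2) *
        ((∫⁻ θ, kernelMass l K A θ ∂H) * (∫⁻ θ, kernelMass l K B θ ∂H)
          + ENNReal.ofReal (ρ ^ h) * ∫⁻ θ, kernelMass l K A θ * kernelMass l K B θ ∂H))
      + if h = 0 then
          k t * (ENNReal.ofReal (c₀ / (1 - ρ)) * ∫⁻ θ, kernelMass l K (A ∩ B) θ ∂H) else 0 := by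
  have hKA := measurable_kernelMass (l := l) hK A
  have hKB := measurable_kernelMass (l := l) hK B
  have hKI := measurable_kernelMass (l := l) hK (A ∩ B)
  have hmA := hN.marg.measurable_lintegral ht hKA
  have hmB := hN.marg.measurable_lintegral (t := t + h) (by omega) hKB
  have hmI := hN.marg.measurable_lintegral ht hKI
  have hsA := hN.marg.shotNoiseIntensity_apply (l := l) hK (k t) ht
  have hsB := hN.marg.shotNoiseIntensity_apply (l := l) hK (k (t + h)) (t := t + h) (by omega)
  rw [← h4.lintegral_mul_lintegral hN.marg ht h hKA hKB, ← lintegral_const_mul _ (by fun_prop)]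
  split_ifs with h0
  · subst h0
    simp only [add_zero] at hmB ⊢
    rw [← h4.lintegral_lintegral hN.marg ht hKI, ← lintegral_const_mul _ hmI,
      ← lintegral_add_left (by fun_prop), hN.lintegral_apply_mul_apply ht hA hB]
    refine lintegral_congr_ae ?_
    filter_upwards [hsA] with ω h1
    rw [h1 A hA, h1 B hB, h1 _ (hA.inter hB)]
    ring
  · rw [hN.lintegral_apply_mul_apply_of_ne ht (by omega) (by omega) hA hB, add_zero]
    refine lintegral_congr_ae ?_
    filter_upwards [hsA, hsB] with ω h1 h2
    rw [h1 A hA, h2 B hB]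
    ring

omit [MetricSpace Θ] [IsProbabilityMeasure P] in
lemma CondH1.lintegral_kernelMass_lt_top [MetricSpace Y] [SFinite l] [SFinite H]
    (hK : Measurable (Function.uncurry K)) {W₁ : Ω → Measure Θ} (h1 : CondH1 P H l K W₁)
    {B : Set Y} (hB : MeasurableSet B) (hb : Bornology.IsBounded B) :
    ∫⁻ θ, kernelMass l K B θ ∂H < ∞ := by
  rw [← setLIntegral_lintegral_eq_lintegral_kernelMass hK]
  refine lt_of_le_of_lt (lintegral_mono fun y => ?_) (h1 B hB hb).2
  exact lintegral_mono' (Measure.le_add_right le_rfl) le_rfl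

omit [MetricSpace Θ] [IsProbabilityMeasure P] in
lemma CondH2.lintegral_kernelMass_mul_lt_top [MetricSpace Y] [SFinite l] [SFinite H]
    (hK : Measurable (Function.uncurry K)) {W₁ : Ω → Measure Θ} (h2 : CondH2 P H l K W₁)
    {A B : Set Y} (hA : MeasurableSet A) (hAb : Bornology.IsBounded A)
    (hB : MeasurableSet B) (hBb : Bornology.IsBounded B) :
    ∫⁻ θ, kernelMass l K A θ * kernelMass l K B θ ∂H < ∞ := by
  refine lt_of_le_of_lt ?_ (h2 A B hA hAb hB hBb)
  have hKy : ∀ θ, Measurable fun y => (K y θ : ℝ≥0∞) := fun θ =>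
    hK.of_uncurry_right.coe_nnreal_ennreal
  calc ∫⁻ θ, kernelMass l K A θ * kernelMass l K B θ ∂H
      = ∫⁻ θ, ∫⁻ p in A ×ˢ B, (K p.1 θ : ℝ≥0∞) * K p.2 θ ∂(l.prod l) ∂H := by
        refine lintegral_congr fun θ => ?_
        rw [← Measure.prod_restrict, lintegral_prod_mul (hKy θ).aemeasurable (hKy θ).aemeasurable]
        rfl
    _ = ∫⁻ p in A ×ˢ B, ∫⁻ θ, (K p.1 θ : ℝ≥0∞) * K p.2 θ ∂H ∂(l.prod l) := by
        refine lintegral_lintegral_swap (Measurable.aemeasurable ?_)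
        have e1 : Measurable fun x : Θ × (Y × Y) => K x.2.1 x.1 :=
          hK.comp (measurable_snd.fst.prodMk measurable_fst)
        have e2 : Measurable fun x : Θ × (Y × Y) => K x.2.2 x.1 :=
          hK.comp (measurable_snd.snd.prodMk measurable_fst)
        exact e1.coe_nnreal_ennreal.mul e2.coe_nnreal_ennreal
    _ ≤ _ := lintegral_mono fun y => lintegral_mono' (Measure.le_add_right le_rfl) le_rfl

/-- Only `X`, `Z` and `X Z` are assumed to have finite integrals, not the squares, so the centred
product is expanded directly. -/
lemma covariance_toReal {X Z : Ω → ℝ≥0∞} (hX : Measurable X) (hZ : Measurable Z)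
    (hXt : ∫⁻ ω, X ω ∂P ≠ ∞) (hZt : ∫⁻ ω, Z ω ∂P ≠ ∞) (hXZ : ∫⁻ ω, X ω * Z ω ∂P ≠ ∞) :
    Integrable (fun ω => (X ω).toReal) P ∧ Integrable (fun ω => (Z ω).toReal) P ∧
      Integrable (fun ω => (X ω).toReal * (Z ω).toReal) P ∧
      cov[fun ω => (X ω).toReal, fun ω => (Z ω).toReal; P] =
        (∫⁻ ω, X ω * Z ω ∂P).toReal - (∫⁻ ω, X ω ∂P).toReal * (∫⁻ ω, Z ω ∂P).toReal := by
  have i1 := integrable_toReal_of_lintegral_ne_top hX.aemeasurable hXt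
  have i2 := integrable_toReal_of_lintegral_ne_top hZ.aemeasurable hZt
  have i3 := integrable_toReal_of_lintegral_ne_top (hX.mul hZ).aemeasurable hXZ
  have e1 := integral_toReal hX.aemeasurable (ae_lt_top hX hXt)
  have e2 := integral_toReal hZ.aemeasurable (ae_lt_top hZ hZt)
  have e3 := integral_toReal (hX.mul hZ).aemeasurable (ae_lt_top (hX.mul hZ) hXZ)
  simp only [Pi.mul_apply, ENNReal.toReal_mul] at i3 e3
  refine ⟨i1, i2, i3, ?_⟩
  rw [← e1, ← e2, ← e3, covariance]
  set a := ∫ ω, (X ω).toReal ∂P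
  set b := ∫ ω, (Z ω).toReal ∂P
  have h : ∀ ω, ((X ω).toReal - a) * ((Z ω).toReal - b) =
      (X ω).toReal * (Z ω).toReal - b * (X ω).toReal - a * (Z ω).toReal + a * b := fun ω => by ring
  simp_rw [h]
  have j1 := i1.const_mul b
  have j2 := i2.const_mul a
  rw [integral_add (by exact (i3.sub j1).sub j2) (integrable_const _),
    integral_sub (by exact i3.sub j1) j2, integral_sub i3 j1,
    integral_const_mul, integral_const_mul, integral_const]
  simp only [probReal_univ, one_smul]
  change _ - b * a - a * b + a * b = _
  ring

end Cox

/-! ### Stationary mean and covariance -/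

theorem corollary3
    {Θ Y Ω : Type*}
    [MetricSpace Θ] [PolishSpace Θ] [MeasurableSpace Θ] [BorelSpace Θ]
    [MetricSpace Y] [PolishSpace Y] [MeasurableSpace Y] [BorelSpace Y]
    [MeasurableSpace Ω] (P : Measure Ω) [IsProbabilityMeasure P]
    (H : Measure Θ) (β c : ℕ → ℝ)
    (l : Measure Y) [SigmaFinite l]
    (K : Y → Θ → ℝ≥0) (hK : Measurable (Function.uncurry K))
    (k : ℕ → ℝ≥0)
    (W : ℕ → Ω → Measure Θ) (N : ℕ → Ω → Measure Y)
    (hN : IsSNMARG P H β c l K k W N)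
    (h1 : CondH1 P H l K (W 1))
    (h2 : CondH2 P H l K (W 1))
    (h3 : CondH3 P l K (W 1))
    (b₀ c₀ ρ : ℝ) (h4 : CondH4 P H β c b₀ c₀ ρ (W 1)) :
    -- the mean of `N t B`, as an identity in `[0, ∞]`
    (∀ t : ℕ, 1 ≤ t → ∀ B : Set Y, MeasurableSet B →
      ∫⁻ ω, N t ω B ∂P
        = ENNReal.ofReal (c₀ * k t / (1 - ρ)) * ∫⁻ θ, kernelMass l K B θ ∂H) ∧
    -- for bounded sets all the integrals in the formulas are finite
    (∀ B₁ B₂ : Set Y, MeasurableSet B₁ → Bornology.IsBounded B₁ →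
      MeasurableSet B₂ → Bornology.IsBounded B₂ →
      ∫⁻ θ, kernelMass l K B₁ θ ∂H < ∞ ∧
      ∫⁻ θ, kernelMass l K B₁ θ * kernelMass l K B₂ θ ∂H < ∞) ∧
    -- the covariance, whenever the integrals in the formulas are finite
    (∀ t h : ℕ, 1 ≤ t → ∀ B₁ B₂ : Set Y, MeasurableSet B₁ → MeasurableSet B₂ →
      ∫⁻ θ, kernelMass l K B₁ θ ∂H < ∞ →
      ∫⁻ θ, kernelMass l K B₂ θ ∂H < ∞ →
      ∫⁻ θ, kernelMass l K B₁ θ * kernelMass l K B₂ θ ∂H < ∞ →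
      Integrable (fun ω => (N t ω B₁).toReal) P ∧
      Integrable (fun ω => (N (t + h) ω B₂).toReal) P ∧
      Integrable (fun ω => (N t ω B₁).toReal * (N (t + h) ω B₂).toReal) P ∧
      cov[fun ω => (N t ω B₁).toReal, fun ω => (N (t + h) ω B₂).toReal; P]
        = (if h = 0 then
            c₀ * k t / (1 - ρ) * ∫ θ, (kernelMass l K (B₁ ∩ B₂) θ).toReal ∂H else 0)
          + ρ ^ h * c₀ ^ 2 * k t * k (t + h) / (1 - ρ) ^ 2
            * ∫ θ, (kernelMass l K B₁ θ).toReal * (kernelMass l K B₂ θ).toReal ∂H) := by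

  have hσ := hN.marg.base.sigmaFinite
  have hc := h4.c_pos hN.marg
  have hρ := h4.ρ_pos hN.marg
  have hρ1 : 0 < 1 - ρ := sub_pos.2 h4.ρ_lt_one
  refine ⟨fun t ht B hB => ?_, fun B₁ B₂ hB₁ hb₁ hB₂ hb₂ =>
    ⟨h1.lintegral_kernelMass_lt_top hK hB₁ hb₁,
      h2.lintegral_kernelMass_mul_lt_top hK hB₁ hb₁ hB₂ hb₂⟩,
    fun t h ht B₁ B₂ hB₁ hB₂ hf₁ hf₂ hf₁₂ => ?_⟩
  · rw [hN.lintegral_apply_of_condH4 hK h4 ht hB, ← mul_assoc, ← ENNReal.ofReal_coe_nnreal,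
      ← ENNReal.ofReal_mul (by positivity)]
    congr 2
    ring
  have hth : 1 ≤ t + h := by omega
  have hm₁ := (Measure.measurable_coe hB₁).comp (hN.measurable t ht)
  have hm₂ := (Measure.measurable_coe hB₂).comp (hN.measurable (t + h) hth)
  have hK₁ := measurable_kernelMass (l := l) hK B₁
  have hK₂ := measurable_kernelMass (l := l) hK B₂
  have hKI := measurable_kernelMass (l := l) hK (B₁ ∩ B₂)
  -- The diagonal term is finite because `kernelMass` is monotone in the set.
  have hfI : ∫⁻ θ, kernelMass l K (B₁ ∩ B₂) θ ∂H < ∞ :=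
    lt_of_le_of_lt (lintegral_mono fun θ => lintegral_mono_set Set.inter_subset_left) hf₁
  have e₁ := hN.lintegral_apply_of_condH4 hK h4 ht hB₁
  have e₂ := hN.lintegral_apply_of_condH4 hK h4 hth hB₂
  have e₁₂ := hN.lintegral_apply_mul_apply_of_condH4 hK h4 ht h hB₁ hB₂
  have hprod : k t * k (t + h) * (ENNReal.ofReal ((c₀ / (1 - ρ)) ^ 2) *
        ((∫⁻ θ, kernelMass l K B₁ θ ∂H) * (∫⁻ θ, kernelMass l K B₂ θ ∂H)
          + ENNReal.ofReal (ρ ^ h) * ∫⁻ θ, kernelMass l K B₁ θ * kernelMass l K B₂ θ ∂H)) ≠ ∞ := by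
    finiteness
  have hdiag : (if h = 0 then k t * (ENNReal.ofReal (c₀ / (1 - ρ)) *
      ∫⁻ θ, kernelMass l K (B₁ ∩ B₂) θ ∂H) else 0) ≠ ∞ := by
    split_ifs <;> finiteness
  obtain ⟨i₁, i₂, i₃, hcov⟩ := covariance_toReal hm₁ hm₂
    (e₁.trans_ne (by finiteness)) (e₂.trans_ne (by finiteness))
    (e₁₂.trans_ne (ENNReal.add_ne_top.2 ⟨hprod, hdiag⟩))
  refine ⟨i₁, i₂, i₃, hcov.trans ?_⟩
  have r₁₂ : ∫ θ, (kernelMass l K B₁ θ).toReal * (kernelMass l K B₂ θ).toReal ∂H =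
      (∫⁻ θ, kernelMass l K B₁ θ * kernelMass l K B₂ θ ∂H).toReal := by
    simp_rw [← ENNReal.toReal_mul]
    exact integral_toReal (hK₁.mul hK₂).aemeasurable (ae_lt_top (hK₁.mul hK₂) hf₁₂.ne)
  rw [r₁₂, integral_toReal hKI.aemeasurable (ae_lt_top hKI hfI.ne)]
  simp only [Function.comp_apply]
  rw [e₁, e₂, e₁₂, ENNReal.toReal_add hprod hdiag]
  have hq : 0 ≤ c₀ / (1 - ρ) := by positivity
  simp only [ENNReal.toReal_mul, ENNReal.toReal_ofReal hq, ENNReal.toReal_ofReal (sq_nonneg _),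
    ENNReal.coe_toReal]
  rw [ENNReal.toReal_add (by finiteness) (by finiteness)]
  simp only [ENNReal.toReal_mul, ENNReal.toReal_ofReal (pow_nonneg hρ.le h)]
  -- The product of the two `H`-integrals in the mixed moment cancels against the product of the
  -- means.
  split_ifs with h0
  · simp only [ENNReal.toReal_mul, ENNReal.toReal_ofReal hq, ENNReal.coe_toReal]
    field_simp
    ring
  · simp only [ENNReal.toReal_zero]
    field_simp
    ring
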